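/- Let $n\ge 2$ be an integer. Let $\mathfrak{C}_n=\{0,1,\dots,n-1\}^{\omega}$ be the Cantor set of infinite descending paths from the root in the infinite rooted $n$-ary tree, with the product topology, and for a finite word $u$ over $\{0,\dots,n-1\}$ call $u\mathfrak{C}_n=\{ux : x\in\mathfrak{C}_n\}$ the interval under the node $u$. The Higman--Thompson group $V_n$ is the group, under composition, of all homeomorphisms $h$ of $\mathfrak{C}_n$ for which there are finite rooted $n$-ary trees $A$ and $B$ and a bijection $\sigma$ from the leaves of $A$ to the leaves of $B$ such that $h(ux)=\sigma(u)x$ for every leaf $u$ of $A$ and every $x\in\mathfrak{C}_n$. A subgroup $H$ of a group $G$ is called undistorted if $G$ and $H$ are finitely generated and, for all finite generating sets $S$ of $G$ and $T$ of $H$, there is a constant $C$ such that $|h|_T\le C\,|h|_S$ for every $h\in H$. Here $|g|_S$ denotes the word length of $g$, that is, the least length of a product of elements of $S$ and their inverses that is equal to $g$. Theorem. If $\alpha\in V_n$ has infinite order, then the cyclic subgroup $\langle\alpha\rangle$ is undistorted in $V_n$. -/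

import Mathlib

/-- The Cantor set `𝔠_n`: the infinite descending paths, starting at the root, in the infinite
rooted `n`-ary tree, with the product topology. -/
abbrev CantorSpace (n : ℕ) : Type := ℕ → Fin n

/-- `prepend u x` is the infinite path that first follows the finite word `u` and then `x`.
The interval (cone) under the node named `u` is the set of all `prepend u x`, and
`x ↦ prepend u x` is its affine order-preserving parametrization by the whole Cantor set. -/
def prepend {n : ℕ} : List (Fin n) → CantorSpace n → CantorSpace n
  | [], x => x
  | i :: u, x => fun k => Nat.casesOn k i (prepend u x)

theorem prepend_append {n : ℕ} (u v : List (Fin n)) (x : CantorSpace n) :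
    prepend (u ++ v) x = prepend u (prepend v x) := by
  induction u with
  | nil => rfl
  | cons i u ih => simp [prepend, ih]

/-- Finite rooted `n`-ary trees: every vertex is a leaf or has exactly `n` ordered children. -/
inductive NTree (n : ℕ) : Type
  | leaf : NTree n
  | node : (Fin n → NTree n) → NTree n

namespace NTree

/-- The type of leaves of a finite `n`-ary tree. -/
def Leaves {n : ℕ} : NTree n → Type
  | leaf => Unit
  | node c => Σ i : Fin n, Leaves (c i)

/-- The name of a leaf: the word that records the descending path from the root to it. -/
def word {n : ℕ} : (T : NTree n) → T.Leaves → List (Fin n)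
  | leaf, _ => []
  | node c, l => l.1 :: word (c l.1) l.2

/-- Replace every leaf `l` of a tree by a tree `f l`. -/
def graft {n : ℕ} : (T : NTree n) → (T.Leaves → NTree n) → NTree n
  | leaf, f => f ()
  | node c, f => node fun i => graft (c i) fun l => f ⟨i, l⟩

/-- The leaves of a grafted tree are pairs of a leaf of the tree and a leaf of what is put
there. -/
def graftEquiv {n : ℕ} : (T : NTree n) → (f : T.Leaves → NTree n) →
    (Σ l : T.Leaves, (f l).Leaves) ≃ (T.graft f).Leaves
  | leaf, f => Equiv.uniqueSigma (α := Unit) fun l => (f l).Leaves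
  | node c, f =>
      (Equiv.sigmaAssoc fun (i : Fin n) (l : (c i).Leaves) => (f ⟨i, l⟩).Leaves).trans
        (Equiv.sigmaCongrRight fun i => graftEquiv (c i) fun l => f ⟨i, l⟩)

theorem word_graftEquiv {n : ℕ} (T : NTree n) (f : T.Leaves → NTree n) (l : T.Leaves)
    (m : (f l).Leaves) :
    (T.graft f).word (graftEquiv T f ⟨l, m⟩) = T.word l ++ (f l).word m := by
  induction T with
  | leaf => rfl
  | node c ih =>
    obtain ⟨i, l⟩ := l
    exact congrArg (List.cons i) (ih i (fun l => f ⟨i, l⟩) l m)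

theorem exists_common_graft {n : ℕ} (S T : NTree n) :
    ∃ (f : S.Leaves → NTree n) (g : T.Leaves → NTree n), S.graft f = T.graft g := by
  have graft_leaf : ∀ T : NTree n, T.graft (fun _ => leaf) = T := by
    intro T
    induction T with
    | leaf => rfl
    | node c ih => exact congrArg node (funext fun i => ih i)
  induction S generalizing T with
  | leaf => exact ⟨fun _ => T, fun _ => leaf, (graft_leaf T).symm⟩
  | node c ih =>
    cases T with
    | leaf => exact ⟨fun _ => leaf, fun _ => node c, graft_leaf (node c)⟩
    | node d =>
      choose f g h using fun i => ih i (d i)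
      exact ⟨fun l => f l.1 l.2, fun l => g l.1 l.2, congrArg node (funext h)⟩

end NTree

/-- The tree pair `(A, B, σ)` represents the homeomorphism `h` of the Cantor set: for every leaf
`l` of `A`, `h` maps the interval under `l` onto the interval under the leaf `σ l` of `B` by the
affine order-preserving map.  The bijection `σ` says that `A` and `B` have the same number of
leaves and is the permutation of their labels. -/
def Represents {n : ℕ} (A B : NTree n) (σ : A.Leaves ≃ B.Leaves)
    (h : CantorSpace n ≃ₜ CantorSpace n) : Prop :=
  ∀ (l : A.Leaves) (x : CantorSpace n), h (prepend (A.word l) x) = prepend (B.word (σ l)) x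

theorem Represents.inv {n : ℕ} {A B : NTree n} {σ : A.Leaves ≃ B.Leaves}
    {h : CantorSpace n ≃ₜ CantorSpace n} (H : Represents A B σ h) :
    Represents B A σ.symm h⁻¹ := by
  intro l x
  have := H (σ.symm l) x
  rw [Equiv.apply_symm_apply] at this
  rw [← this]
  exact h.symm_apply_apply _

theorem Represents.graft {n : ℕ} {A B : NTree n} {σ : A.Leaves ≃ B.Leaves}
    {h : CantorSpace n ≃ₜ CantorSpace n} (H : Represents A B σ h) (f : B.Leaves → NTree n) :
    ∃ (A' : NTree n) (σ' : A'.Leaves ≃ (B.graft f).Leaves),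
      Represents A' (B.graft f) σ' h := by
  refine ⟨A.graft fun l => f (σ l), (NTree.graftEquiv A _).symm.trans
    ((Equiv.sigmaCongrLeft (β := fun b => (f b).Leaves) σ).trans (NTree.graftEquiv B f)), ?_⟩
  intro l x
  obtain ⟨⟨l, m⟩, rfl⟩ := (NTree.graftEquiv A fun l => f (σ l)).surjective l
  have e : (Equiv.sigmaCongrLeft (β := fun b => (f b).Leaves) σ) ⟨l, m⟩ = ⟨σ l, m⟩ := rfl
  simp only [Equiv.trans_apply, Equiv.symm_apply_apply, e, NTree.word_graftEquiv,
    prepend_append]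
  exact H l _

/-- The Higman--Thompson group `V_n`: all homeomorphisms of the Cantor set `𝔠_n` that are
represented by a tree pair, under composition. -/
def HigmanThompson (n : ℕ) : Subgroup (CantorSpace n ≃ₜ CantorSpace n) where
  carrier := {h | ∃ (A B : NTree n) (σ : A.Leaves ≃ B.Leaves), Represents A B σ h}
  one_mem' := ⟨NTree.leaf, NTree.leaf, Equiv.refl _, fun _ _ => rfl⟩
  inv_mem' := by
    rintro h ⟨A, B, σ, H⟩
    exact ⟨B, A, σ.symm, H.inv⟩
  mul_mem' := by
    rintro g h ⟨C, D, τ, K⟩ ⟨A, B, σ, H⟩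
    obtain ⟨f, k, e⟩ := NTree.exists_common_graft B C
    obtain ⟨A', σ', H'⟩ := H.graft f
    have K₁ := K.inv.graft k
    rw [← e] at K₁
    obtain ⟨D', τ', K'⟩ := K₁
    refine ⟨A', D', σ'.trans τ'.symm, fun l x => ?_⟩
    have h2 := K'.inv (σ' l) x
    rw [inv_inv] at h2
    rw [Equiv.trans_apply, ← h2, ← H' l x]
    rfl

/-- The word length of `g` with respect to a generating set `S`: the least length of a word in
the elements of `S` and their inverses whose product is `g`. -/
noncomputable def wordLength {G : Type*} [Group G] (S : Set G) (g : G) : ℕ :=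
  sInf {k | ∃ w : List G, w.length = k ∧ (∀ s ∈ w, s ∈ S ∨ s⁻¹ ∈ S) ∧ w.prod = g}

/-- A subgroup `H` of a group `G` is undistorted: both groups are finitely generated and, for all
finite generating sets `S` of `G` and `T` of `H`, the word length in `H` of the elements of `H` is
bounded by a linear function of their word length in `G`. -/
def IsUndistorted {G : Type*} [Group G] (H : Subgroup G) : Prop :=
  Group.FG G ∧ Group.FG H ∧
    ∀ (S : Set G) (T : Set H), S.Finite → Subgroup.closure S = ⊤ →
      T.Finite → Subgroup.closure T = ⊤ →
      ∃ C : ℕ, ∀ h : H, wordLength T h ≤ C * wordLength S (h : G)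

/-!
Elements of `V_n` are handled through complete prefix codes: `IsCode k s` says that `s` is the set
of leaf names of an `n`-ary tree with `k` interior vertices, and the elements of `V_n` are the
homeomorphisms mapping the cones of one code affinely to those of another one
(`mem_higmanThompson_iff`).

*Finite generation.* Let `g` be represented by a pair of trees with `k + 1` interior vertices each,
where `4 ≤ k`. The domain tree has a caret `P`, the range tree a caret with preimage `Q`, and there
are so many leaves that `n` further leaves `R` of the domain avoid both `P` and `Q`. Passing through
a tree with two disjoint carets, `g` becomes a product of three elements such that the first keeps
`P` together as a caret, the second `R`, and the third `Q`. Each of them is then represented by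
smaller trees (`exists_eq_mul_mul`), so that the finitely many elements with at most four interior
vertices generate `V_n` (`fg_higmanThompson`).

*An attracting cone.* Let `S k` be the amount by which `g ^ k` lengthens long prefixes of a point
`x`. If `S i` is minimal among the values `S j` with `i ≤ j ≤ l`, then the prefix of `(g ^ i) x` of a
suitable fixed length never becomes too short between times `i` and `l`, so that `g ^ (l - i)` is affine
on the cone under it; if `S l` is minimal, the same holds for the way back. Infinitely many times are
minimal among all later ones, or infinitely many among all earlier ones, and the pigeonhole principle
gives two such times with the same prefix `q`. Hence a nontrivial power of `g` maps the cone under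
`q` affinely to the cone under some `q ++ w` (`exists_zpow_mapsCone_append`). If `w` were always
empty, every point would have a neighbourhood fixed by a nontrivial power of `g`, and by compactness
`g` would have finite order. So for `g` of infinite order some `w` is nonempty
(`exists_attracting_cone`).

*The lower bound.* An element of `V_n` destroys the agreement of two points in at most boundedly many
coordinates, so an element of word length `m` destroys at most `C * m` of them
(`exists_losesAtMost_mul_wordLength`). The inverse of the `k`-th power of the map above destroys at
least `k` of them. Hence the word length of `α ^ k` grows linearly in `k`
(`exists_natAbs_le_mul_wordLength`).
-/

/-! ### Words, cones and the maps between cones -/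

section Words

variable {n : ℕ}

theorem prepend_injective (u : List (Fin n)) : Function.Injective (prepend u) := by
  induction u with
  | nil => exact fun _ _ h => h
  | cons i u ih => exact fun x y h => ih (funext fun k => congrFun h (k + 1))

theorem prepend_apply_add (u : List (Fin n)) (x : CantorSpace n) (k : ℕ) :
    prepend u x (u.length + k) = x k := by
  induction u with
  | nil => simp [prepend]
  | cons i u ih =>
    rw [List.length_cons, show u.length + 1 + k = (u.length + k) + 1 by omega]
    exact ih

theorem prepend_apply_of_lt (u : List (Fin n)) (x y : CantorSpace n) {k : ℕ}
    (hk : k < u.length) : prepend u x k = prepend u y k := by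
  induction u generalizing k with
  | nil => simp at hk
  | cons i u ih =>
    cases k with
    | zero => rfl
    | succ k => exact ih (by simpa using hk)

theorem exists_eq_prepend (m : ℕ) (x : CantorSpace n) :
    ∃ u : List (Fin n), u.length = m ∧ ∃ y, x = prepend u y := by
  induction m generalizing x with
  | zero => exact ⟨[], rfl, x, rfl⟩
  | succ m ih =>
    obtain ⟨u, hu, y, hy⟩ := ih fun k => x (k + 1)
    refine ⟨x 0 :: u, by simp [hu], y, funext fun k => ?_⟩
    cases k with
    | zero => rfl
    | succ k => exact congrFun hy k

/-- Two words naming cones with a common point are comparable. -/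
theorem exists_append_of_prepend_eq {u v : List (Fin n)} {x y : CantorSpace n}
    (h : prepend u x = prepend v y) (hl : u.length ≤ v.length) :
    ∃ w, v = u ++ w ∧ x = prepend w y := by
  induction u generalizing v with
  | nil => exact ⟨v, rfl, h⟩
  | cons i u ih =>
    cases v with
    | nil => simp at hl
    | cons j v =>
      obtain ⟨w, rfl, hw⟩ := ih (funext fun k => congrFun h (k + 1)) (by simpa using hl)
      have h0 : i = j := congrFun h 0
      exact ⟨w, by simp [h0], hw⟩

theorem prepend_eq_prepend_of_agree {m : ℕ} {x y : CantorSpace n} (h : ∀ i < m, x i = y i) :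
    ∃ u : List (Fin n), u.length = m ∧ ∃ x' y', x = prepend u x' ∧ y = prepend u y' := by
  induction m generalizing x y with
  | zero => exact ⟨[], rfl, x, y, rfl, rfl⟩
  | succ m ih =>
    obtain ⟨u, hu, x', y', hx, hy⟩ := ih (x := fun k => x (k + 1)) (y := fun k => y (k + 1))
      fun i hi => h (i + 1) (by omega)
    refine ⟨x 0 :: u, by simp [hu], x', y', funext fun k => ?_, funext fun k => ?_⟩
    · cases k with
      | zero => rfl
      | succ k => exact congrFun hx k
    · cases k with
      | zero => exact (h 0 (by omega)).symm
      | succ k => exact congrFun hy k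

theorem continuous_prepend (u : List (Fin n)) : Continuous (prepend u) := by
  induction u with
  | nil => exact continuous_id
  | cons i u ih =>
    refine continuous_pi fun k => ?_
    cases k with
    | zero => exact continuous_const
    | succ k => exact (continuous_apply k).comp ih

theorem isOpen_range_prepend (u : List (Fin n)) : IsOpen (Set.range (prepend u)) := by
  induction u with
  | nil =>
    convert isOpen_univ
    exact Set.range_eq_univ.2 fun x => ⟨x, rfl⟩
  | cons i u ih =>
    have hs : Continuous fun (x : CantorSpace n) (k : ℕ) => x (k + 1) :=
      continuous_pi fun k => continuous_apply (k + 1)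
    have h0 : IsOpen {x : CantorSpace n | x 0 = i} :=
      (isOpen_discrete {i}).preimage (continuous_apply (A := fun _ : ℕ => Fin n) 0)
    convert h0.inter (ih.preimage hs)
    ext x
    constructor
    · rintro ⟨y, rfl⟩
      exact ⟨rfl, y, rfl⟩
    · rintro ⟨h, y, hy⟩
      refine ⟨y, funext fun k => ?_⟩
      cases k with
      | zero => exact h.symm
      | succ k => exact congrFun hy k

/-- `g` maps the cone under `u` onto the cone under `v` by the affine order-preserving map. -/
def MapsCone (g : CantorSpace n ≃ₜ CantorSpace n) (u v : List (Fin n)) : Prop :=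
  ∀ x, g (prepend u x) = prepend v x

namespace MapsCone

variable {g h : CantorSpace n ≃ₜ CantorSpace n} {u v w : List (Fin n)}

protected theorem one (u : List (Fin n)) : MapsCone 1 u u := fun _ => rfl

theorem mul (hg : MapsCone g v w) (hh : MapsCone h u v) : MapsCone (g * h) u w := fun x => by
  rw [Homeomorph.mul_apply, hh, hg]

theorem inv (hg : MapsCone g u v) : MapsCone g⁻¹ v u := fun x => by
  rw [← hg x]
  exact g.symm_apply_apply _

theorem append (hg : MapsCone g u v) (r : List (Fin n)) : MapsCone g (u ++ r) (v ++ r) :=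
  fun x => by rw [prepend_append, prepend_append, hg]

end MapsCone

end Words

/-! ### Complete prefix codes -/

section Codes

variable {n : ℕ}

/-- The code obtained from `s` by replacing the word `v` by its `n` children. -/
def expandCode (s : Finset (List (Fin n))) (v : List (Fin n)) : Finset (List (Fin n)) :=
  s.erase v ∪ Finset.univ.image fun i => v ++ [i]

/-- `IsCode k s`: the set `s` of words is obtained from `{[]}` by `k` successive expansions.
Equivalently, `s` is the set of names of the leaves of a finite `n`-ary tree with `k` interior
vertices. -/
inductive IsCode : ℕ → Finset (List (Fin n)) → Prop
  | root : IsCode 0 {[]}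
  | expand {k : ℕ} {s : Finset (List (Fin n))} {v : List (Fin n)} :
      IsCode k s → v ∈ s → IsCode (k + 1) (expandCode s v)

theorem mem_expandCode {s : Finset (List (Fin n))} {v u : List (Fin n)} :
    u ∈ expandCode s v ↔ (u ≠ v ∧ u ∈ s) ∨ ∃ i, v ++ [i] = u := by
  simp [expandCode]

theorem append_mem_expandCode (s : Finset (List (Fin n))) (v : List (Fin n)) (i : Fin n) :
    v ++ [i] ∈ expandCode s v :=
  mem_expandCode.2 (Or.inr ⟨i, rfl⟩)

theorem append_singleton_injective (v : List (Fin n)) :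
    Function.Injective fun i : Fin n => v ++ [i] := fun i j h => by simpa using h

theorem exists_prepend_singleton (x : CantorSpace n) : ∃ i y, x = prepend [i] y := by
  obtain ⟨u, hu, y, hy⟩ := exists_eq_prepend 1 x
  obtain ⟨i, rfl⟩ := List.length_eq_one_iff.1 hu
  exact ⟨i, y, hy⟩

namespace IsCode

variable {k l : ℕ} {s t : Finset (List (Fin n))}

/-- Every point lies in the cone of some word of a code. -/
theorem exists_mem (hs : IsCode k s) (x : CantorSpace n) : ∃ u ∈ s, ∃ y, x = prepend u y := by
  induction hs with
  | root => exact ⟨[], by simp, x, rfl⟩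
  | @expand k s v _ _ ih =>
    obtain ⟨u, hu, y, rfl⟩ := ih
    by_cases h : u = v
    · obtain ⟨i, z, rfl⟩ := exists_prepend_singleton y
      exact ⟨v ++ [i], append_mem_expandCode s v i, z, by rw [h, prepend_append]⟩
    · exact ⟨u, mem_expandCode.2 (Or.inl ⟨h, hu⟩), y, rfl⟩

/-- The cones of distinct words of a code are disjoint. -/
theorem eq_of_prepend_eq (hs : IsCode k s) {u v : List (Fin n)} (hu : u ∈ s) (hv : v ∈ s)
    {x y : CantorSpace n} (h : prepend u x = prepend v y) : u = v := by
  induction hs generalizing u v x y with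
  | root => simp_all
  | @expand k s w _ hw ih =>
    rcases mem_expandCode.1 hu with ⟨h1, h2⟩ | ⟨i, rfl⟩ <;>
      rcases mem_expandCode.1 hv with ⟨h3, h4⟩ | ⟨j, rfl⟩
    · exact ih h2 h4 h
    · rw [prepend_append] at h
      exact absurd (ih h2 hw h) h1
    · rw [prepend_append] at h
      exact absurd (ih hw h4 h) (Ne.symm h3)
    · rw [prepend_append, prepend_append] at h
      have h0 : i = j := congrFun (prepend_injective w h) 0
      rw [h0]

theorem append_notMem [NeZero n] (hs : IsCode k s) {v : List (Fin n)} (hv : v ∈ s) (i : Fin n) :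
    v ++ [i] ∉ s := fun h => by
  have := hs.eq_of_prepend_eq h hv (prepend_append v [i] fun _ => 0)
  simp at this

theorem card_eq [NeZero n] (hs : IsCode k s) : s.card = 1 + k * (n - 1) := by
  induction hs with
  | root => simp
  | @expand k s v hs hv ih =>
    rw [expandCode, Finset.card_union_of_disjoint, Finset.card_erase_of_mem hv,
      Finset.card_image_of_injective _ (append_singleton_injective v), ih, Finset.card_univ,
      Fintype.card_fin, Nat.succ_mul]
    · have := NeZero.pos n
      omega
    · rw [Finset.disjoint_left]
      intro u hu hu'
      obtain ⟨i, -, rfl⟩ := Finset.mem_image.1 hu'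
      exact hs.append_notMem hv i (Finset.mem_of_mem_erase hu)

theorem exists_expandCode_of_succ (hs : IsCode (k + 1) s) :
    ∃ s₀ v, IsCode k s₀ ∧ v ∈ s₀ ∧ s = expandCode s₀ v := by
  cases hs with
  | expand h hv => exact ⟨_, _, h, hv, rfl⟩

theorem nonempty [NeZero n] (hs : IsCode k s) : s.Nonempty := by
  rw [← Finset.card_pos, hs.card_eq]
  omega

theorem exists_isCode [NeZero n] (k : ℕ) : ∃ s : Finset (List (Fin n)), IsCode k s := by
  induction k with
  | zero => exact ⟨_, root⟩
  | succ k ih =>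
    obtain ⟨s, hs⟩ := ih
    obtain ⟨v, hv⟩ := hs.nonempty
    exact ⟨_, hs.expand hv⟩

end IsCode

theorem finite_setOf_isCode (k : ℕ) : {s : Finset (List (Fin n)) | IsCode k s}.Finite := by
  induction k with
  | zero =>
    refine (Set.finite_singleton {[]}).subset fun s hs => ?_
    cases hs
    rfl
  | succ k ih =>
    refine (ih.biUnion fun s _ => s.finite_toSet.image (expandCode s)).subset fun s hs => ?_
    obtain ⟨s₀, v, h, hv, rfl⟩ := IsCode.exists_expandCode_of_succ hs
    exact Set.mem_biUnion h ⟨v, hv, rfl⟩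

/-- The order in which two words of a code are expanded does not matter. -/
theorem expandCode_comm [NeZero n] {k : ℕ} {s : Finset (List (Fin n))} (hs : IsCode k s)
    {v w : List (Fin n)} (hv : v ∈ s) (hw : w ∈ s) :
    expandCode (expandCode s v) w = expandCode (expandCode s w) v := by
  ext u
  have h1 : ∀ i, v ++ [i] ≠ w := fun i h => hs.append_notMem hv i (h ▸ hw)
  have h2 : ∀ i, w ++ [i] ≠ v := fun i h => hs.append_notMem hw i (h ▸ hv)
  simp only [mem_expandCode]
  constructor <;> rintro (⟨h, ⟨h', h''⟩ | ⟨i, rfl⟩⟩ | ⟨i, rfl⟩) <;> simp_all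

end Codes

/-! ### Codes as leaf sets of trees, and the elements of `V_n` -/

section Trees

variable {n : ℕ}

theorem NTree.word_injective (T : NTree n) : Function.Injective T.word := by
  induction T with
  | leaf => exact fun _ _ _ => rfl
  | node c ih =>
    rintro ⟨i, l⟩ ⟨j, m⟩ h
    obtain ⟨h0, h1⟩ := List.cons.inj h
    dsimp only at h0
    subst h0
    exact congrArg (Sigma.mk i) (ih i h1)

/-- Hanging a tree below a word of a code gives a code. -/
theorem NTree.exists_isCode_hang [NeZero n] (T : NTree n) {k : ℕ} {s : Finset (List (Fin n))}
    (hs : IsCode k s) {u : List (Fin n)} (hu : u ∈ s) :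
    ∃ k' s', IsCode k' s' ∧ ∀ w, w ∈ s' ↔ (w ≠ u ∧ w ∈ s) ∨ ∃ l, w = u ++ T.word l := by
  induction T generalizing k s u with
  | leaf =>
    refine ⟨k, s, hs, fun w => ⟨fun hw => ?_, ?_⟩⟩
    · by_cases h : w = u
      · exact Or.inr ⟨(), by simp [word, h]⟩
      · exact Or.inl ⟨h, hw⟩
    · rintro (h | ⟨l, rfl⟩)
      · exact h.2
      · simpa [word] using hu
  | node c ih =>
    -- Expand `u`, then hang the subtrees `c i` below the children `u ++ [i]`, one after the other.
    have key : ∀ F : Finset (Fin n), ∃ k' s', IsCode k' s' ∧ ∀ w, w ∈ s' ↔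
        (w ≠ u ∧ w ∈ s) ∨ (∃ i, i ∉ F ∧ w = u ++ [i]) ∨
          ∃ i ∈ F, ∃ l, w = u ++ i :: (c i).word l := by
      intro F
      induction F using Finset.induction_on with
      | empty =>
        refine ⟨_, _, hs.expand hu, fun w => ?_⟩
        rw [mem_expandCode]
        simp [eq_comm]
      | insert j F hj ihF =>
        obtain ⟨k', s', hs', H⟩ := ihF
        obtain ⟨k'', s'', hs'', H'⟩ := ih j hs' ((H _).2 (Or.inr (Or.inl ⟨j, hj, rfl⟩)))
        refine ⟨k'', s'', hs'', fun w => ?_⟩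
        rw [H', H]
        constructor
        · rintro (⟨h, h' | ⟨i, hi, rfl⟩ | ⟨i, hi, l, rfl⟩⟩ | ⟨l, rfl⟩)
          · exact Or.inl h'
          · refine Or.inr (Or.inl ⟨i, ?_, rfl⟩)
            rw [Finset.mem_insert, not_or]
            exact ⟨fun e => h (by rw [e]), hi⟩
          · exact Or.inr (Or.inr ⟨i, Finset.mem_insert_of_mem hi, l, rfl⟩)
          · exact Or.inr (Or.inr ⟨j, Finset.mem_insert_self _ _, l, by simp⟩)
        · rintro (h | ⟨i, hi, rfl⟩ | ⟨i, hi, l, rfl⟩)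
          · refine Or.inl ⟨?_, Or.inl h⟩
            rintro rfl
            exact hs.append_notMem hu j h.2
          · rw [Finset.mem_insert, not_or] at hi
            exact Or.inl ⟨by simpa using hi.1, Or.inr (Or.inl ⟨i, hi.2, rfl⟩)⟩
          · rcases Finset.mem_insert.1 hi with rfl | hi
            · exact Or.inr ⟨l, by simp⟩
            · refine Or.inl ⟨?_, Or.inr (Or.inr ⟨i, hi, l, rfl⟩)⟩
              intro e
              simp only [List.append_cancel_left_eq, List.cons.injEq] at e
              exact hj (e.1 ▸ hi)
    obtain ⟨k', s', hs', H⟩ := key Finset.univ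
    refine ⟨k', s', hs', fun w => (H w).trans (or_congr Iff.rfl ?_)⟩
    constructor
    · rintro (⟨i, hi, -⟩ | ⟨i, -, l, rfl⟩)
      · exact absurd (Finset.mem_univ i) hi
      · exact ⟨⟨i, l⟩, rfl⟩
    · rintro ⟨⟨i, l⟩, rfl⟩
      exact Or.inr ⟨i, Finset.mem_univ i, l, rfl⟩

theorem NTree.exists_isCode [NeZero n] (T : NTree n) :
    ∃ k s, IsCode k s ∧ ∀ w, w ∈ s ↔ ∃ l, T.word l = w := by
  obtain ⟨k, s, hs, H⟩ := T.exists_isCode_hang IsCode.root (Finset.mem_singleton_self [])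
  refine ⟨k, s, hs, fun w => ?_⟩
  rw [H]
  simp [eq_comm]

theorem IsCode.exists_tree {k : ℕ} {s : Finset (List (Fin n))} (hs : IsCode k s) :
    ∃ T : NTree n, ∀ w, w ∈ s ↔ ∃ l, T.word l = w := by
  classical
  induction hs with
  | root =>
    refine ⟨NTree.leaf, fun w => ?_⟩
    simp only [Finset.mem_singleton, NTree.word]
    exact ⟨fun h => ⟨(), h.symm⟩, fun ⟨_, h⟩ => h.symm⟩
  | @expand k s v _ hv ih =>
    obtain ⟨T, hT⟩ := ih
    let f : T.Leaves → NTree n := fun l =>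
      if T.word l = v then NTree.node fun _ => NTree.leaf else NTree.leaf
    have hf : ∀ l w, (∃ m, (f l).word m = w) ↔
        (T.word l ≠ v ∧ w = []) ∨ (T.word l = v ∧ ∃ i, w = [i]) := by
      intro l w
      by_cases h : T.word l = v
      · have e : f l = NTree.node fun _ => NTree.leaf := if_pos h
        rw [e]
        constructor
        · rintro ⟨⟨i, m⟩, rfl⟩
          exact Or.inr ⟨h, i, rfl⟩
        · rintro (h' | ⟨-, i, rfl⟩)
          · exact absurd h h'.1
          · exact ⟨⟨i, ()⟩, rfl⟩
      · have e : f l = NTree.leaf := if_neg h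
        rw [e]
        constructor
        · rintro ⟨m, rfl⟩
          exact Or.inl ⟨h, rfl⟩
        · rintro (⟨-, rfl⟩ | h')
          · exact ⟨(), rfl⟩
          · exact absurd h'.1 h
    refine ⟨T.graft f, fun w => ?_⟩
    rw [mem_expandCode]
    constructor
    · rintro (⟨h, hw⟩ | ⟨i, rfl⟩)
      · obtain ⟨l, rfl⟩ := (hT w).1 hw
        obtain ⟨m, hm⟩ := (hf l []).2 (Or.inl ⟨h, rfl⟩)
        exact ⟨NTree.graftEquiv T f ⟨l, m⟩, by rw [NTree.word_graftEquiv, hm, List.append_nil]⟩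
      · obtain ⟨l, rfl⟩ := (hT v).1 hv
        obtain ⟨m, hm⟩ := (hf l [i]).2 (Or.inr ⟨rfl, i, rfl⟩)
        exact ⟨NTree.graftEquiv T f ⟨l, m⟩, by rw [NTree.word_graftEquiv, hm]⟩
    · rintro ⟨x, rfl⟩
      obtain ⟨⟨l, m⟩, rfl⟩ := (NTree.graftEquiv T f).surjective x
      rw [NTree.word_graftEquiv]
      rcases (hf l _).1 ⟨m, rfl⟩ with ⟨h, h'⟩ | ⟨h, i, h'⟩
      · rw [h', List.append_nil]
        exact Or.inl ⟨h, (hT _).2 ⟨l, rfl⟩⟩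
      · rw [h', h]
        exact Or.inr ⟨i, rfl⟩

/-- `g` maps the cones of the words in `s` to the cones of the words in `t`, each by the affine
order-preserving map, and every word in `t` is attained. For codes `s` and `t` this is the relation
between an element of `V_n` and the leaf sets of a tree pair representing it. -/
def MapsCode (g : CantorSpace n ≃ₜ CantorSpace n) (s t : Finset (List (Fin n))) : Prop :=
  (∀ u ∈ s, ∃ v ∈ t, MapsCone g u v) ∧ ∀ v ∈ t, ∃ u ∈ s, MapsCone g u v

namespace MapsCode

variable {g h : CantorSpace n ≃ₜ CantorSpace n} {r s t : Finset (List (Fin n))}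

theorem inv (hg : MapsCode g s t) : MapsCode g⁻¹ t s := by
  refine ⟨fun v hv => ?_, fun u hu => ?_⟩
  · obtain ⟨u, hu, H⟩ := hg.2 v hv
    exact ⟨u, hu, H.inv⟩
  · obtain ⟨v, hv, H⟩ := hg.1 u hu
    exact ⟨v, hv, H.inv⟩

theorem mul (hg : MapsCode g s t) (hh : MapsCode h r s) : MapsCode (g * h) r t := by
  refine ⟨fun u hu => ?_, fun w hw => ?_⟩
  · obtain ⟨v, hv, H⟩ := hh.1 u hu
    obtain ⟨w, hw, H'⟩ := hg.1 v hv
    exact ⟨w, hw, H'.mul H⟩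
  · obtain ⟨v, hv, H⟩ := hg.2 w hw
    obtain ⟨u, hu, H'⟩ := hh.2 v hv
    exact ⟨u, hu, H.mul H'⟩

end MapsCode

/-- A homeomorphism is injective, so it cannot map the cones of two different words of a code onto
the same cone. -/
theorem MapsCone.left_unique [NeZero n] {g : CantorSpace n ≃ₜ CantorSpace n} {k : ℕ}
    {s : Finset (List (Fin n))} (hs : IsCode k s) {u u' v : List (Fin n)} (hu : u ∈ s)
    (hu' : u' ∈ s) (h : MapsCone g u v) (h' : MapsCone g u' v) : u = u' :=
  hs.eq_of_prepend_eq hu hu'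
    (g.injective ((h fun _ => 0).trans (h' fun _ => 0).symm))

theorem MapsCone.right_unique [NeZero n] {g : CantorSpace n ≃ₜ CantorSpace n} {k : ℕ}
    {t : Finset (List (Fin n))} (ht : IsCode k t) {u v v' : List (Fin n)} (hv : v ∈ t)
    (hv' : v' ∈ t) (h : MapsCone g u v) (h' : MapsCone g u v') : v = v' :=
  h.inv.left_unique ht hv hv' h'.inv

theorem MapsCode.exists_equiv [NeZero n] {g : CantorSpace n ≃ₜ CantorSpace n} {k l : ℕ}
    {s t : Finset (List (Fin n))} (hg : MapsCode g s t) (hs : IsCode k s) (ht : IsCode l t) :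
    ∃ e : s ≃ t, ∀ u : s, MapsCone g u (e u) := by
  choose f hf H using hg.1
  refine ⟨Equiv.ofBijective (fun u => ⟨f u u.2, hf u u.2⟩) ⟨fun u u' huu' => ?_, fun v => ?_⟩,
    fun u => H u u.2⟩
  · have e : f u u.2 = f u' u'.2 := congrArg Subtype.val huu'
    exact Subtype.ext (MapsCone.left_unique hs u.2 u'.2 (H u u.2) (e ▸ H u' u'.2))
  · obtain ⟨u, hu, hv⟩ := hg.2 v v.2
    exact ⟨⟨u, hu⟩, Subtype.ext (MapsCone.right_unique ht (hf u hu) v.2 (H u hu) hv)⟩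

theorem mapsCode_of_equiv {g : CantorSpace n ≃ₜ CantorSpace n} {s t : Finset (List (Fin n))}
    (e : s ≃ t) (he : ∀ u : s, MapsCone g u (e u)) : MapsCode g s t := by
  refine ⟨fun u hu => ⟨e ⟨u, hu⟩, (e ⟨u, hu⟩).2, he ⟨u, hu⟩⟩, fun v hv => ?_⟩
  refine ⟨e.symm ⟨v, hv⟩, (e.symm ⟨v, hv⟩).2, ?_⟩
  have := he (e.symm ⟨v, hv⟩)
  rwa [e.apply_symm_apply] at this

/-- The elements of `V_n` are the homeomorphisms that map a code to a code with the same number of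
expansions. -/
theorem mem_higmanThompson_iff (hn : 2 ≤ n) {g : CantorSpace n ≃ₜ CantorSpace n} :
    g ∈ HigmanThompson n ↔ ∃ k s t, IsCode k s ∧ IsCode k t ∧ MapsCode g s t := by
  have : NeZero n := ⟨by omega⟩
  constructor
  · rintro ⟨A, B, σ, H⟩
    obtain ⟨k, s, hs, hA⟩ := A.exists_isCode
    obtain ⟨l, t, ht, hB⟩ := B.exists_isCode
    have hg : MapsCode g s t := by
      refine ⟨fun u hu => ?_, fun v hv => ?_⟩
      · obtain ⟨a, rfl⟩ := (hA u).1 hu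
        exact ⟨_, (hB _).2 ⟨σ a, rfl⟩, H a⟩
      · obtain ⟨b, rfl⟩ := (hB v).1 hv
        refine ⟨_, (hA _).2 ⟨σ.symm b, rfl⟩, fun x => ?_⟩
        rw [H, σ.apply_symm_apply]
    obtain ⟨e, -⟩ := hg.exists_equiv hs ht
    have hc : s.card = t.card := by simpa using Fintype.card_congr e
    rw [hs.card_eq, ht.card_eq] at hc
    have hkl : k = l := Nat.eq_of_mul_eq_mul_right (by omega : 0 < n - 1) (by omega)
    exact ⟨k, s, t, hs, hkl ▸ ht, hg⟩
  · rintro ⟨k, s, t, hs, ht, hg⟩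
    obtain ⟨e, he⟩ := hg.exists_equiv hs ht
    have key : ∀ {k} {s : Finset (List (Fin n))}, IsCode k s →
        ∃ (T : NTree n) (d : T.Leaves ≃ s), ∀ l, T.word l = d l := by
      intro k s hs
      obtain ⟨T, hT⟩ := hs.exists_tree
      refine ⟨T, Equiv.ofBijective (fun l => ⟨T.word l, (hT _).2 ⟨l, rfl⟩⟩)
        ⟨fun l m h => T.word_injective (congrArg Subtype.val h), fun w => ?_⟩, fun l => rfl⟩
      obtain ⟨l, hl⟩ := (hT w).1 w.2
      exact ⟨l, Subtype.ext hl⟩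
    obtain ⟨A, a, hA⟩ := key hs
    obtain ⟨B, b, hB⟩ := key ht
    refine ⟨A, B, a.trans (e.trans b.symm), fun l x => ?_⟩
    rw [hA, hB, he]
    simp

/-- A bijection between two codes is realized by a homeomorphism. -/
theorem exists_mapsCone_of_equiv [NeZero n] {k l : ℕ} {s t : Finset (List (Fin n))}
    (hs : IsCode k s) (ht : IsCode l t) (e : s ≃ t) :
    ∃ g : CantorSpace n ≃ₜ CantorSpace n, ∀ u : s, MapsCone g u (e u) := by
  have key : ∀ {k} {s t : Finset (List (Fin n))}, IsCode k s → ∀ e : s → t,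
      ∃ f : CantorSpace n → CantorSpace n, Continuous f ∧
        ∀ (u : s) x, f (prepend u x) = prepend (e u) x := by
    intro k s t hs e
    have H : ∀ x, ∃ (u : s) (y : CantorSpace n), x = prepend u y := fun x =>
      let ⟨u, hu, y, hy⟩ := hs.exists_mem x
      ⟨⟨u, hu⟩, y, hy⟩
    choose a y hy using H
    have hay : ∀ (u : s) x, a (prepend u x) = u ∧ y (prepend u x) = x := by
      intro u x
      have h : u = a (prepend u x) :=
        Subtype.ext (hs.eq_of_prepend_eq u.2 (a (prepend u x)).2 (hy (prepend u x)))
      refine ⟨h.symm, prepend_injective u ?_⟩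
      conv_rhs => rw [hy (prepend u x), ← h]
    refine ⟨fun x => prepend (e (a x)) (y x), ?_, fun u x => by
      dsimp only
      rw [(hay u x).1, (hay u x).2]⟩
    rw [continuous_iff_continuousAt]
    intro x
    -- On the open cone under `a x` the map deletes a prefix and puts another one in its place.
    have hd : Continuous fun z : CantorSpace n =>
        prepend (e (a x)) fun k => z ((a x : List (Fin n)).length + k) :=
      (continuous_prepend _).comp (continuous_pi fun k => continuous_apply _)
    refine hd.continuousAt.congr ?_
    filter_upwards [(isOpen_range_prepend (a x)).mem_nhds ⟨y x, (hy x).symm⟩]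
    rintro _ ⟨z, rfl⟩
    simp only [prepend_apply_add, (hay (a x) z).1, (hay (a x) z).2]
  obtain ⟨f, hf, Hf⟩ := key hs e
  obtain ⟨f', hf', Hf'⟩ := key ht e.symm
  refine ⟨⟨⟨f, f', fun x => ?_, fun x => ?_⟩, hf, hf'⟩, Hf⟩
  · obtain ⟨u, hu, y, rfl⟩ := hs.exists_mem x
    rw [Hf ⟨u, hu⟩, Hf', e.symm_apply_apply]
  · obtain ⟨u, hu, y, rfl⟩ := ht.exists_mem x
    rw [Hf' ⟨u, hu⟩, Hf, e.apply_symm_apply]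

/-- A partial injection between two codes with the same number of expansions extends to an element
of `V_n` that maps the one code to the other. -/
theorem exists_mapsCode_extending [NeZero n] {k : ℕ} {s t : Finset (List (Fin n))}
    (hs : IsCode k s) (ht : IsCode k t) {ι : Type*} [Fintype ι] {a b : ι → List (Fin n)}
    (ha : Function.Injective a) (hb : Function.Injective b) (has : ∀ i, a i ∈ s)
    (hbt : ∀ i, b i ∈ t) :
    ∃ g : CantorSpace n ≃ₜ CantorSpace n, MapsCode g s t ∧ ∀ i, MapsCone g (a i) (b i) := by
  classical
  let a' : ι → s := fun i => ⟨a i, has i⟩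
  have ha' : Function.Injective a' := fun i j h => ha (congrArg Subtype.val h)
  have hext : ∀ i, Function.extend a' b (fun _ => []) (a' i) = b i := fun i =>
    ha'.extend_apply _ _ i
  obtain ⟨e, he⟩ := Finset.exists_equiv_extend_of_card_eq (α := s) (t := t)
    (s := Finset.univ.image a') (f := Function.extend a' b fun _ => [])
    (by rw [Fintype.card_coe, hs.card_eq, ht.card_eq])
    (by
      intro w hw
      obtain ⟨u, hu, rfl⟩ := Finset.mem_image.1 hw
      obtain ⟨i, -, rfl⟩ := Finset.mem_image.1 hu
      rw [hext]
      exact hbt i)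
    (by
      intro u hu u' hu' h
      obtain ⟨i, -, rfl⟩ := Finset.mem_image.1 (Finset.mem_coe.1 hu)
      obtain ⟨j, -, rfl⟩ := Finset.mem_image.1 (Finset.mem_coe.1 hu')
      rw [hext, hext] at h
      rw [hb h])
  obtain ⟨g, hg⟩ := exists_mapsCone_of_equiv hs ht e
  refine ⟨g, mapsCode_of_equiv e hg, fun i => ?_⟩
  have := hg (a' i)
  rwa [he _ (Finset.mem_image_of_mem _ (Finset.mem_univ i)), hext] at this

end Trees

/-! ### Finite generation of `V_n` -/

section FiniteGeneration

variable {n : ℕ}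

theorem MapsCode.exists_of_expandCode [NeZero n] {g : CantorSpace n ≃ₜ CantorSpace n} {k : ℕ}
    {s t : Finset (List (Fin n))} {v w : List (Fin n)} (hs : IsCode k s) (hv : v ∈ s) (hw : w ∈ t)
    (hg : MapsCode g (expandCode s v) (expandCode t w))
    (H : ∀ i, MapsCone g (v ++ [i]) (w ++ [i])) : ∀ u ∈ s, ∃ b ∈ t, MapsCone g u b := by
  intro u hu
  by_cases huv : u = v
  · refine ⟨w, hw, fun x => ?_⟩
    obtain ⟨i, y, rfl⟩ := exists_prepend_singleton x
    rw [huv, ← prepend_append, H, prepend_append]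
  · have hu' : u ∈ expandCode s v := mem_expandCode.2 (Or.inl ⟨huv, hu⟩)
    obtain ⟨b, hb, hub⟩ := hg.1 u hu'
    rcases mem_expandCode.1 hb with ⟨-, hbt⟩ | ⟨i, rfl⟩
    · exact ⟨b, hbt, hub⟩
    · have := MapsCone.left_unique (hs.expand hv) hu' (append_mem_expandCode s v i) hub (H i)
      exact absurd (this ▸ hu) (hs.append_notMem hv i)

/-- Reduction of a tree pair: a common caret of the two trees can be deleted. -/
theorem MapsCode.of_expandCode [NeZero n] {g : CantorSpace n ≃ₜ CantorSpace n} {k l : ℕ}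
    {s t : Finset (List (Fin n))} {v w : List (Fin n)} (hs : IsCode k s) (ht : IsCode l t)
    (hv : v ∈ s) (hw : w ∈ t) (hg : MapsCode g (expandCode s v) (expandCode t w))
    (H : ∀ i, MapsCone g (v ++ [i]) (w ++ [i])) : MapsCode g s t := by
  refine ⟨hg.exists_of_expandCode hs hv hw H, fun b hb => ?_⟩
  obtain ⟨u, hu, h⟩ := hg.inv.exists_of_expandCode ht hw hv (fun i => (H i).inv) b hb
  exact ⟨u, hu, by simpa using h.inv⟩

/-- The elements of `V_n` represented by pairs of trees with `k` interior vertices each. -/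
def levelSet (n k : ℕ) : Set (CantorSpace n ≃ₜ CantorSpace n) :=
  {g | ∃ s t, IsCode k s ∧ IsCode k t ∧ MapsCode g s t}

theorem finite_levelSet [NeZero n] (k : ℕ) : (levelSet n k).Finite := by
  have hfin : ∀ s t : Finset (List (Fin n)), IsCode k s →
      (⋃ f : s → t, {g : CantorSpace n ≃ₜ CantorSpace n |
        ∀ u : s, MapsCone g u (f u)}).Finite := by
    intro s t hs
    refine Set.finite_iUnion fun f => Set.Subsingleton.finite fun g hg h hh => ?_
    ext1 x
    obtain ⟨u, hu, y, rfl⟩ := hs.exists_mem x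
    rw [hg ⟨u, hu⟩, hh ⟨u, hu⟩]
  refine ((finite_setOf_isCode k).biUnion fun s hs =>
    (finite_setOf_isCode k).biUnion fun t _ => hfin s t hs).subset ?_
  rintro g ⟨s, t, hs, ht, hg⟩
  obtain ⟨e, he⟩ := hg.exists_equiv hs ht
  exact Set.mem_biUnion hs (Set.mem_biUnion ht (Set.mem_iUnion.2 ⟨e, he⟩))

theorem exists_injective_avoiding {α ι κ : Type*} [DecidableEq α] [Fintype ι] [Fintype κ]
    {s : Finset α} (f : κ → α) (h : Fintype.card κ + Fintype.card ι ≤ s.card) :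
    ∃ r : ι → α, Function.Injective r ∧ (∀ i, r i ∈ s) ∧ ∀ i j, r i ≠ f j := by
  have hc : Fintype.card ι ≤ (s \ Finset.univ.image f).card := by
    have h1 := Finset.le_card_sdiff (Finset.univ.image f) s
    have h2 : (Finset.univ.image f).card ≤ Fintype.card κ := Finset.card_image_le
    omega
  obtain ⟨e⟩ : Nonempty (ι ↪ (s \ Finset.univ.image f : Finset α)) :=
    Function.Embedding.nonempty_of_card_le (by simpa using hc)
  refine ⟨fun i => e i, fun i j h => e.injective (Subtype.ext h),
    fun i => (Finset.mem_sdiff.1 (e i).2).1, fun i j hij => ?_⟩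
  have hij : (e i : α) = f j := hij
  exact (Finset.mem_sdiff.1 (e i).2).2 (hij ▸ Finset.mem_image_of_mem f (Finset.mem_univ j))

/-- An element represented by large trees is a product of three elements represented by trees with
one interior vertex less. -/
theorem exists_eq_mul_mul (hn : 2 ≤ n) {k : ℕ} (hk : 4 ≤ k)
    {g : CantorSpace n ≃ₜ CantorSpace n} (hg : g ∈ levelSet n (k + 1)) :
    ∃ g₁ ∈ levelSet n k, ∃ g₂ ∈ levelSet n k, ∃ g₃ ∈ levelSet n k, g = g₃ * (g₂ * g₁) := by
  have : NeZero n := ⟨by omega⟩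
  obtain ⟨s, t, hs, ht, hg⟩ := hg
  have hcard := hs.card_eq
  obtain ⟨s₀, v, hs₀, hv, rfl⟩ := hs.exists_expandCode_of_succ
  obtain ⟨t₀, w, ht₀, hw, rfl⟩ := ht.exists_expandCode_of_succ
  -- A code `C` containing all children of two different words `c₁`, `c₂`.
  obtain ⟨D, hD⟩ := IsCode.exists_isCode (n := n) (k - 1)
  obtain ⟨c₁, h₁, c₂, h₂, hne⟩ : ∃ c₁ ∈ D, ∃ c₂ ∈ D, c₁ ≠ c₂ := by
    rw [← Finset.one_lt_card, hD.card_eq]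
    have := Nat.mul_pos (show 0 < k - 1 by omega) (show 0 < n - 1 by omega)
    omega
  have hk1 : k - 1 + 1 = k := by omega
  have hD₁ : IsCode k (expandCode D c₁) := hk1 ▸ hD.expand h₁
  have hD₂ : IsCode k (expandCode D c₂) := hk1 ▸ hD.expand h₂
  have h₂' : c₂ ∈ expandCode D c₁ := mem_expandCode.2 (Or.inl ⟨hne.symm, h₂⟩)
  have h₁' : c₁ ∈ expandCode D c₂ := mem_expandCode.2 (Or.inl ⟨hne, h₁⟩)
  have hcomm := expandCode_comm hD h₁ h₂
  obtain ⟨C, hC⟩ : ∃ C, C = expandCode (expandCode D c₁) c₂ := ⟨_, rfl⟩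
  have hCode : IsCode (k + 1) C := hC ▸ hD₁.expand h₂'
  have m₂ : ∀ i, c₂ ++ [i] ∈ C := fun i => hC ▸ append_mem_expandCode _ _ i
  have m₁ : ∀ i, c₁ ++ [i] ∈ C := fun i => hC ▸ hcomm ▸ append_mem_expandCode _ _ i
  have hc12 : ∀ i j, c₁ ++ [i] ≠ c₂ ++ [j] := fun i j h =>
    hne (List.append_inj_left' h (by simp))
  have i₁ := append_singleton_injective c₁
  have i₂ := append_singleton_injective c₂
  -- `Q` is the preimage of the caret at `w`, and `R` avoids both `Q` and the caret at `v`.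
  choose Q hQ hQw using fun i => hg.2 (w ++ [i]) (append_mem_expandCode t₀ w i)
  have iQ : Function.Injective Q := fun i j h =>
    append_singleton_injective w <| MapsCone.right_unique ht (append_mem_expandCode t₀ w i)
      (append_mem_expandCode t₀ w j) (hQw i) (h ▸ hQw j)
  obtain ⟨R, iR, hR, hRne⟩ := exists_injective_avoiding (ι := Fin n) (κ := Fin n ⊕ Fin n)
    (s := expandCode s₀ v) (Sum.elim (fun i => v ++ [i]) Q) (by
      rw [hcard]
      simp only [Fintype.card_sum, Fintype.card_fin]
      have : 5 * (n - 1) ≤ (k + 1) * (n - 1) := Nat.mul_le_mul_right _ (by omega)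
      omega)
  -- `g₁` moves the caret at `v` to `c₁` and `R` to `c₂`.
  obtain ⟨g₁, hg₁, e₁⟩ := exists_mapsCode_extending hs hCode
    (a := Sum.elim (fun i => v ++ [i]) R)
    (b := Sum.elim (fun i => c₁ ++ [i]) fun i => c₂ ++ [i])
    ((append_singleton_injective v).sumElim iR fun i j h => hRne j (Sum.inl i) h.symm)
    (i₁.sumElim i₂ hc12)
    (by rintro (i | i); exacts [append_mem_expandCode _ _ i, hR i])
    (by rintro (i | i); exacts [m₁ i, m₂ i])
  choose Q' hQ' hQQ' using fun i => hg₁.1 (Q i) (hQ i)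
  have iQ' : Function.Injective Q' := fun i j h =>
    iQ (MapsCone.left_unique hs (hQ i) (hQ j) (hQQ' i) (h ▸ hQQ' j))
  have hQ'2 : ∀ i j, c₂ ++ [i] ≠ Q' j := fun i j h =>
    hRne i (Sum.inr j) (MapsCone.left_unique hs (hR i) (hQ j) (e₁ (Sum.inr i)) (by
      simpa [h] using hQQ' j))
  -- `g₂` moves the caret at `c₂` to `c₁` and the image of `Q` to the caret at `c₂`.
  obtain ⟨g₂, hg₂, e₂⟩ := exists_mapsCode_extending hCode hCode
    (a := Sum.elim (fun i => c₂ ++ [i]) Q')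
    (b := Sum.elim (fun i => c₁ ++ [i]) fun i => c₂ ++ [i])
    (i₂.sumElim iQ' hQ'2) (i₁.sumElim i₂ hc12)
    (by rintro (i | i); exacts [m₂ i, hQ' i])
    (by rintro (i | i); exacts [m₁ i, m₂ i])
  have hg₃ : MapsCode (g * (g₂ * g₁)⁻¹) C (expandCode t₀ w) := hg.mul (hg₂.mul hg₁).inv
  refine ⟨g₁, ⟨_, _, hs₀, hD₂, ?_⟩, g₂, ⟨_, _, hD₁, hD₂, ?_⟩, g * (g₂ * g₁)⁻¹,
    ⟨_, _, hD₁, ht₀, ?_⟩, by group⟩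
  · rw [hC, hcomm] at hg₁
    exact hg₁.of_expandCode hs₀ hD₂ hv h₁' fun i => e₁ (Sum.inl i)
  · have hg₂' : MapsCode g₂ (expandCode (expandCode D c₁) c₂)
        (expandCode (expandCode D c₂) c₁) := by rwa [← hcomm, ← hC]
    exact hg₂'.of_expandCode hD₁ hD₂ h₂' h₁' fun i => e₂ (Sum.inl i)
  · rw [hC] at hg₃
    exact hg₃.of_expandCode hD₁ ht₀ h₂' hw fun i =>
      (hQw i).mul ((e₂ (Sum.inr i)).mul (hQQ' i)).inv

theorem levelSet_subset_closure (hn : 2 ≤ n) (k : ℕ) :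
    levelSet n k ⊆ Subgroup.closure (⋃ j ∈ Set.Iic 4, levelSet n j) := by
  induction k with
  | zero => exact fun g hg => Subgroup.subset_closure (Set.mem_biUnion (by simp) hg)
  | succ k ih =>
    intro g hg
    by_cases hk : k + 1 ≤ 4
    · exact Subgroup.subset_closure (Set.mem_biUnion hk hg)
    · obtain ⟨g₁, h₁, g₂, h₂, g₃, h₃, rfl⟩ := exists_eq_mul_mul hn (by omega) hg
      exact mul_mem (ih h₃) (mul_mem (ih h₂) (ih h₁))

theorem fg_higmanThompson (hn : 2 ≤ n) : Group.FG (HigmanThompson n) := by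
  have : NeZero n := ⟨by omega⟩
  rw [Group.fg_iff_subgroup_fg, Subgroup.fg_iff]
  refine ⟨⋃ j ∈ Set.Iic 4, levelSet n j, le_antisymm ?_ ?_,
    (Set.finite_Iic 4).biUnion fun j _ => finite_levelSet j⟩
  · rw [Subgroup.closure_le]
    intro g hg
    obtain ⟨j, -, s, t, hs, ht, h⟩ := Set.mem_iUnion₂.1 hg
    exact (mem_higmanThompson_iff hn).2 ⟨j, s, t, hs, ht, h⟩
  · intro g hg
    obtain ⟨k, hk⟩ := (mem_higmanThompson_iff hn).1 hg
    exact levelSet_subset_closure hn k hk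

end FiniteGeneration

/-! ### Attracting and repelling cones of elements of infinite order -/

section Dynamics

variable {n : ℕ}

/-- Near `x` an element of `V_n` changes the length of prefixes by a constant `c x`, provided the
prefix is not shorter than some bound that depends on the element only. -/
theorem exists_length_change (hn : 2 ≤ n) {g : CantorSpace n ≃ₜ CantorSpace n}
    (hg : g ∈ HigmanThompson n) : ∃ (D : ℕ) (c : CantorSpace n → ℤ),
      (∀ p y, D ≤ p.length → ∃ p', (p'.length : ℤ) = p.length + c (prepend p y) ∧
        MapsCone g p p') ∧
      ∀ x p' y, D ≤ p'.length → g x = prepend p' y →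
        ∃ p, (p'.length : ℤ) = p.length + c x ∧ MapsCone g p p' := by
  obtain ⟨k, s, t, hs, ht, hst⟩ := (mem_higmanThompson_iff hn).1 hg
  have H : ∀ x, ∃ u ∈ s, ∃ v ∈ t, MapsCone g u v ∧ ∃ y, x = prepend u y := by
    intro x
    obtain ⟨u, hu, y, hy⟩ := hs.exists_mem x
    obtain ⟨v, hv, huv⟩ := hst.1 u hu
    exact ⟨u, hu, v, hv, huv, y, hy⟩
  choose u hu v hv huv z hz using H
  refine ⟨(s ∪ t).sup List.length, fun x => (v x).length - (u x).length, ?_, ?_⟩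
  · intro p y hp
    obtain ⟨r, hr, -⟩ := exists_append_of_prepend_eq (hz (prepend p y)).symm
      ((Finset.le_sup (f := List.length) (Finset.mem_union_left t (hu _))).trans hp)
    refine ⟨v (prepend p y) ++ r, ?_, ?_⟩
    · have := congrArg List.length hr
      simp only [List.length_append] at this ⊢
      omega
    · have := (huv (prepend p y)).append r
      rwa [← hr] at this
  · intro x p' y hp hx
    have hx' : prepend (v x) (z x) = prepend p' y := by
      rw [← hx, ← huv x (z x), ← hz x]
    obtain ⟨r, rfl, -⟩ := exists_append_of_prepend_eq hx'
      ((Finset.le_sup (f := List.length) (Finset.mem_union_right s (hv _))).trans hp)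
    exact ⟨u x ++ r, by simp only [List.length_append]; omega, (huv x).append r⟩

/-- An integer sequence has infinitely many terms that are minimal among all later terms, or
infinitely many terms that are minimal among all earlier terms. -/
theorem infinite_minimal_after_or_before (S : ℕ → ℤ) :
    {k | ∀ j, k ≤ j → S k ≤ S j}.Infinite ∨ {k | ∀ j, j ≤ k → S k ≤ S j}.Infinite := by
  by_cases hb : ∃ B, ∀ k, B ≤ S k
  · left
    obtain ⟨B, hB⟩ := hb
    refine Set.infinite_of_forall_exists_gt fun m => ?_
    obtain ⟨a, ⟨k, hk, rfl⟩, ha⟩ := Int.exists_least_of_bdd (P := fun a => ∃ j, m < j ∧ S j = a)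
      ⟨B, fun a ⟨j, _, hj⟩ => hj ▸ hB j⟩ ⟨S (m + 1), m + 1, m.lt_succ_self, rfl⟩
    exact ⟨k, fun j hj => ha _ ⟨j, hk.trans_le hj, rfl⟩, hk⟩
  · right
    push Not at hb
    refine Set.infinite_of_forall_exists_gt fun m => ?_
    obtain ⟨B, hB⟩ := ((Set.finite_Iic m).image S).bddBelow
    have hex := hb B
    refine ⟨Nat.find hex, fun j hj => ?_, ?_⟩
    · rcases hj.eq_or_lt with rfl | hj
      · exact le_rfl
      · exact (Nat.find_spec hex).le.trans (not_lt.1 (Nat.find_min hex hj))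
    · by_contra! h
      exact absurd (hB ⟨_, h, rfl⟩) (not_le.2 (Nat.find_spec hex))

/-- Some iterate of every point lies in a cone that a nontrivial power of `g` maps into itself. -/
theorem exists_zpow_mapsCone_append (hn : 2 ≤ n) {g : CantorSpace n ≃ₜ CantorSpace n}
    (hg : g ∈ HigmanThompson n) (x : CantorSpace n) : ∃ (k : ℕ) (r : ℤ) (q w : List (Fin n)),
      r ≠ 0 ∧ (∃ y, (g ^ k) x = prepend q y) ∧ MapsCone (g ^ r) q (q ++ w) := by
  obtain ⟨D, c, hfwd, hbwd⟩ := exists_length_change hn hg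
  -- `S k` is the length change of `g ^ k` near `x`.
  let S : ℕ → ℤ := fun k => ∑ j ∈ Finset.range k, c ((g ^ j) x)
  have hS : ∀ k, S (k + 1) = S k + c ((g ^ k) x) := fun k => Finset.sum_range_succ _ _
  have hsucc : ∀ k, (g ^ (k + 1)) x = g ((g ^ k) x) := fun k => by
    rw [pow_succ', Homeomorph.mul_apply]
  have fwd : ∀ k p y, (g ^ k) x = prepend p y → ∀ m : ℕ,
      (∀ j, k ≤ j → j < k + m → (D : ℤ) ≤ p.length + (S j - S k)) →
      ∃ p', (p'.length : ℤ) = p.length + (S (k + m) - S k) ∧ MapsCone (g ^ m) p p' ∧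
        (g ^ (k + m)) x = prepend p' y := by
    intro k p y hp m
    induction m with
    | zero => exact fun _ => ⟨p, by simp, MapsCone.one p, by simpa using hp⟩
    | succ m ih =>
      intro H
      obtain ⟨p', hl, hm, hx⟩ := ih fun j h1 h2 => H j h1 (by omega)
      obtain ⟨p'', hl', hm'⟩ := hfwd p' y (by
        have := H (k + m) (by omega) (by omega)
        omega)
      refine ⟨p'', ?_, ?_, ?_⟩
      · rw [← add_assoc, hS, hx, hl', hl]
        ring
      · rw [pow_succ']
        exact hm'.mul hm
      · rw [← add_assoc, hsucc, hx, hm']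
  have bwd : ∀ k m : ℕ, ∀ p' y, (g ^ (k + m)) x = prepend p' y →
      (∀ j, k < j → j ≤ k + m → (D : ℤ) ≤ p'.length + (S j - S (k + m))) →
      ∃ p, (p'.length : ℤ) = p.length + (S (k + m) - S k) ∧ MapsCone (g ^ m) p p' := by
    intro k m
    induction m with
    | zero => exact fun p' y _ _ => ⟨p', by simp, MapsCone.one p'⟩
    | succ m ih =>
      intro p' y hp' H
      rw [← add_assoc, hsucc] at hp'
      obtain ⟨p, hl, hm⟩ := hbwd _ p' y (by
        have := H (k + (m + 1)) (by omega) le_rfl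
        omega) hp'
      have hx : (g ^ (k + m)) x = prepend p y := g.injective (hp'.trans (hm y).symm)
      have hS' := hS (k + m)
      obtain ⟨p₀, hl₀, hm₀⟩ := ih p y hx fun j h1 h2 => by
        have := H j h1 (by omega)
        rw [← add_assoc] at this
        omega
      refine ⟨p₀, ?_, ?_⟩
      · rw [← add_assoc]
        omega
      · rw [pow_succ']
        exact hm.mul hm₀
  choose q hq y hy using fun k => exists_eq_prepend D ((g ^ k) x)
  have pigeon : ∀ K : Set ℕ, K.Infinite → ∃ k ∈ K, ∃ m, k + m ∈ K ∧ 0 < m ∧ q k = q (k + m) := by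
    intro K hK
    obtain ⟨k, hk, l, hl, hne, he⟩ := hK.exists_ne_map_eq_of_mapsTo (f := q)
      (t := {p : List (Fin n) | p.length = D}) (fun k _ => hq k) (List.finite_length_eq _ D)
    rcases lt_or_gt_of_ne hne with h | h
    · obtain ⟨m, rfl⟩ := Nat.exists_eq_add_of_le h.le
      exact ⟨k, hk, m, hl, by omega, he⟩
    · obtain ⟨m, rfl⟩ := Nat.exists_eq_add_of_le h.le
      exact ⟨l, hl, m, hk, by omega, he.symm⟩
  rcases infinite_minimal_after_or_before S with hK | hK
  · obtain ⟨k, hk, m, -, hm, he⟩ := pigeon _ hK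
    obtain ⟨p', hl, hmap, hx⟩ := fwd k (q k) (y k) (hy k) m fun j h1 _ => by
      have := hk j h1
      rw [hq]
      omega
    obtain ⟨w, rfl, -⟩ := exists_append_of_prepend_eq (u := q k) (v := p')
      (by rw [← hx, he, ← hy]) (by
        have := hk (k + m) (by omega)
        omega)
    exact ⟨k, m, q k, w, by omega, ⟨_, hy k⟩, by rwa [zpow_natCast]⟩
  · obtain ⟨k, -, m, hkm, hm, he⟩ := pigeon _ hK
    obtain ⟨p, hl, hmap⟩ := bwd k m (q (k + m)) (y (k + m)) (hy _) fun j _ h2 => by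
      have := hkm j h2
      rw [hq]
      omega
    have hx : (g ^ k) x = prepend p (y (k + m)) := by
      apply (g ^ m).injective
      rw [hmap, ← hy, ← Homeomorph.mul_apply, ← pow_add, add_comm]
    obtain ⟨w, rfl, -⟩ := exists_append_of_prepend_eq (u := q k) (v := p)
      (by rw [← hx, ← hy]) (by
        have := hkm k (by omega)
        rw [hq] at hl ⊢
        omega)
    refine ⟨k, -m, q k, w, by omega, ⟨_, hy k⟩, ?_⟩
    rw [zpow_neg, zpow_natCast]
    have := hmap.inv
    rwa [← he] at this

theorem zpow_apply_eq_self {X : Type*} [TopologicalSpace X] {h : X ≃ₜ X} {x : X} (hx : h x = x)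
    (d : ℤ) : (h ^ d) x = x := by
  have hpow : ∀ m : ℕ, (h ^ m) x = x := fun m => by
    induction m with
    | zero => rfl
    | succ m ih => rw [pow_succ', Homeomorph.mul_apply, ih, hx]
  obtain ⟨m, rfl | rfl⟩ := d.eq_nat_or_neg
  · rw [zpow_natCast, hpow]
  · rw [zpow_neg, zpow_natCast]
    apply (h ^ m).injective
    rw [← Homeomorph.mul_apply, mul_inv_cancel, Homeomorph.one_apply, hpow]

/-- An element of `V_n` of infinite order has a nontrivial power that maps some cone to a proper
subcone of it. -/
theorem exists_attracting_cone (hn : 2 ≤ n) {g : CantorSpace n ≃ₜ CantorSpace n}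
    (hg : g ∈ HigmanThompson n) (hinf : ¬ IsOfFinOrder g) :
    ∃ (r : ℤ) (q w : List (Fin n)), w ≠ [] ∧ MapsCone (g ^ r) q (q ++ w) := by
  by_contra! hcon
  apply hinf
  -- Otherwise every point has a neighbourhood on which a nontrivial power of `g` is the identity.
  have hloc : ∀ x, ∃ r : ℤ, r ≠ 0 ∧ ∃ U : Set (CantorSpace n), IsOpen U ∧ x ∈ U ∧
      ∀ z ∈ U, (g ^ r) z = z := by
    intro x
    obtain ⟨k, r, q, w, hr, ⟨y, hy⟩, hm⟩ := exists_zpow_mapsCone_append hn hg x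
    by_cases hw : w = []
    · subst hw
      refine ⟨r, hr, (g ^ k) ⁻¹' Set.range (prepend q),
        (isOpen_range_prepend q).preimage (g ^ k).continuous, ⟨y, hy.symm⟩, ?_⟩
      rintro z ⟨z', hz⟩
      apply (g ^ k).injective
      rw [← Homeomorph.mul_apply, (Commute.pow_self g k).zpow_right r |>.eq,
        Homeomorph.mul_apply, ← hz, hm, List.append_nil]
    · exact absurd hm (hcon r q w hw)
  choose r hr U hU hxU hfix using hloc
  obtain ⟨F, hF⟩ := isCompact_univ.elim_finite_subcover U hU fun x _ =>
    Set.mem_iUnion.2 ⟨x, hxU x⟩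
  rw [isOfFinOrder_iff_zpow_eq_one]
  refine ⟨∏ x ∈ F, r x, Finset.prod_ne_zero_iff.2 fun x _ => hr x, ?_⟩
  ext1 z
  obtain ⟨x, hx, hz⟩ := Set.mem_iUnion₂.1 (hF (Set.mem_univ z))
  obtain ⟨d, hd⟩ := Finset.dvd_prod_of_mem r hx
  rw [hd, zpow_mul]
  exact zpow_apply_eq_self (hfix x z hz) d

theorem MapsCone.pow_append {g : CantorSpace n ≃ₜ CantorSpace n} {q w : List (Fin n)}
    (h : MapsCone g q (q ++ w)) (k : ℕ) : ∃ p, p.length = q.length + k * w.length ∧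
      MapsCone (g ^ k) q p := by
  suffices H : ∃ v, v.length = k * w.length ∧ MapsCone (g ^ k) q (q ++ v) by
    obtain ⟨v, hv, hm⟩ := H
    exact ⟨q ++ v, by simp [hv], hm⟩
  induction k with
  | zero => exact ⟨[], by simp, by simpa using MapsCone.one q⟩
  | succ k ih =>
    obtain ⟨v, hv, hm⟩ := ih
    refine ⟨w ++ v, by simp [hv]; ring, ?_⟩
    rw [pow_succ', ← List.append_assoc]
    exact (h.append v).mul hm

end Dynamics

/-! ### Word lengths -/

section WordLength

variable {G : Type*} [Group G] {S : Set G}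

theorem exists_word_of_closure_eq_top (hS : Subgroup.closure S = ⊤) (g : G) :
    ∃ w : List G, w.length = wordLength S g ∧ (∀ s ∈ w, s ∈ S ∨ s⁻¹ ∈ S) ∧ w.prod = g := by
  have hmem : g ∈ (Subgroup.closure S).toSubmonoid := hS ▸ Subgroup.mem_top g
  rw [Subgroup.closure_toSubmonoid] at hmem
  obtain ⟨w, hw, hg⟩ := Submonoid.exists_list_of_mem_closure hmem
  exact Nat.sInf_mem (s := {k | ∃ w : List G, w.length = k ∧ (∀ s ∈ w, s ∈ S ∨ s⁻¹ ∈ S) ∧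
    w.prod = g}) ⟨_, w, rfl, hw, hg⟩

theorem wordLength_prod_le {w : List G} (hw : ∀ s ∈ w, s ∈ S ∨ s⁻¹ ∈ S) :
    wordLength S w.prod ≤ w.length :=
  Nat.sInf_le ⟨w, rfl, hw, rfl⟩

theorem wordLength_one : wordLength S (1 : G) = 0 :=
  Nat.le_zero.1 (wordLength_prod_le (w := []) (by simp))

theorem wordLength_mul_le (hS : Subgroup.closure S = ⊤) (g h : G) :
    wordLength S (g * h) ≤ wordLength S g + wordLength S h := by
  obtain ⟨v, hv, hv', rfl⟩ := exists_word_of_closure_eq_top hS g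
  obtain ⟨w, hw, hw', rfl⟩ := exists_word_of_closure_eq_top hS h
  rw [← hv, ← hw, ← List.prod_append, ← List.length_append]
  exact wordLength_prod_le fun s hs => (List.mem_append.1 hs).elim (hv' s) (hw' s)

theorem wordLength_inv_le (hS : Subgroup.closure S = ⊤) (g : G) :
    wordLength S g⁻¹ ≤ wordLength S g := by
  obtain ⟨w, hw, hw', rfl⟩ := exists_word_of_closure_eq_top hS g
  rw [← hw, List.prod_inv_reverse]
  refine (wordLength_prod_le fun s hs => ?_).trans (by simp)
  obtain ⟨a, ha, rfl⟩ := List.mem_map.1 (List.mem_reverse.1 hs)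
  simpa using (hw' a ha).symm

theorem wordLength_zpow_le (hS : Subgroup.closure S = ⊤) (g : G) (k : ℤ) :
    wordLength S (g ^ k) ≤ k.natAbs * wordLength S g := by
  have hpow : ∀ m : ℕ, wordLength S (g ^ m) ≤ m * wordLength S g := fun m => by
    induction m with
    | zero => simp [wordLength_one]
    | succ m ih =>
      rw [pow_succ, Nat.succ_mul]
      exact (wordLength_mul_le hS _ _).trans (Nat.add_le_add_right ih _)
  obtain ⟨m, rfl | rfl⟩ := k.eq_nat_or_neg
  · simpa using hpow m
  · rw [zpow_neg, zpow_natCast]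
    simpa using (wordLength_inv_le hS _).trans (hpow m)

end WordLength

/-! ### The lower bound for the word length of powers -/

section Undistorted

variable {n : ℕ}

/-- `g` loses at most `C` coordinates of agreement of two points: if two points agree in their
first `m` coordinates, then their images agree in the first `m - C` coordinates. -/
def LosesAtMost (g : CantorSpace n ≃ₜ CantorSpace n) (C : ℕ) : Prop :=
  ∀ (m : ℕ) (x y : CantorSpace n), (∀ i < m, x i = y i) → ∀ i < m - C, g x i = g y i

theorem LosesAtMost.mono {g : CantorSpace n ≃ₜ CantorSpace n} {C D : ℕ} (hg : LosesAtMost g C)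
    (h : C ≤ D) : LosesAtMost g D := fun m x y hxy i hi => hg m x y hxy i (by omega)

theorem LosesAtMost.mul {g h : CantorSpace n ≃ₜ CantorSpace n} {C D : ℕ} (hg : LosesAtMost g C)
    (hh : LosesAtMost h D) : LosesAtMost (g * h) (C + D) := fun m x y hxy i hi =>
  hg (m - D) (h x) (h y) (hh m x y hxy) i (by omega)

theorem exists_losesAtMost (hn : 2 ≤ n) {g : CantorSpace n ≃ₜ CantorSpace n}
    (hg : g ∈ HigmanThompson n) : ∃ C, LosesAtMost g C := by
  obtain ⟨k, s, t, hs, -, hst⟩ := (mem_higmanThompson_iff hn).1 hg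
  refine ⟨s.sup List.length, fun m x y hxy i hi => ?_⟩
  obtain ⟨u, hu, z, rfl⟩ := hs.exists_mem x
  have hul : u.length ≤ s.sup List.length := Finset.le_sup (f := List.length) hu
  obtain ⟨p, rfl, x', y', hx, rfl⟩ := prepend_eq_prepend_of_agree hxy
  obtain ⟨r, rfl, -⟩ := exists_append_of_prepend_eq hx (by omega)
  obtain ⟨v, -, huv⟩ := hst.1 u hu
  rw [hx, huv.append r, huv.append r]
  refine prepend_apply_of_lt _ _ _ ?_
  simp only [List.length_append] at hi ⊢
  omega

/-- The loss of agreement is bounded by a multiple of the word length. -/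
theorem exists_losesAtMost_mul_wordLength (hn : 2 ≤ n) {S : Set (HigmanThompson n)}
    (hfin : S.Finite) (hS : Subgroup.closure S = ⊤) :
    ∃ C, ∀ g : HigmanThompson n,
      LosesAtMost (g : CantorSpace n ≃ₜ CantorSpace n) (wordLength S g * C) := by
  choose c hc using fun g : HigmanThompson n => exists_losesAtMost hn g.2
  obtain ⟨C, hC⟩ := ((hfin.union hfin.inv).image c).bddAbove
  refine ⟨C, fun g => ?_⟩
  obtain ⟨w, hw, hwS, hg⟩ := exists_word_of_closure_eq_top hS g
  rw [← hw, ← hg]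
  clear hw hg
  induction w with
  | nil => exact fun m x y hxy i hi => hxy i (by omega)
  | cons a w ih =>
    have ha : LosesAtMost (a : CantorSpace n ≃ₜ CantorSpace n) C :=
      (hc a).mono (hC ⟨a, hwS a (by simp), rfl⟩)
    have := ha.mul (ih fun s hs => hwS s (List.mem_cons_of_mem a hs))
    rw [List.prod_cons, List.length_cons, Nat.succ_mul, Nat.add_comm]
    exact this

/-- A homeomorphism mapping the cone under `p` onto the cone under the shorter word `q` loses at
least the difference of the lengths. -/
theorem MapsCone.length_le_of_losesAtMost (hn : 2 ≤ n) {g : CantorSpace n ≃ₜ CantorSpace n}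
    {p q : List (Fin n)} {C : ℕ} (hg : MapsCone g p q) (hC : LosesAtMost g C) :
    p.length ≤ q.length + C := by
  by_contra! h
  have := hC p.length (prepend p fun _ => ⟨0, by omega⟩) (prepend p fun _ => ⟨1, by omega⟩)
    (fun i hi => prepend_apply_of_lt _ _ _ hi) (q.length + 0) (by omega)
  rw [hg, hg, prepend_apply_add, prepend_apply_add] at this
  simp at this

theorem exists_natAbs_le_mul_wordLength (hn : 2 ≤ n) {α : HigmanThompson n}
    (hα : ¬ IsOfFinOrder α) {S : Set (HigmanThompson n)} (hfin : S.Finite)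
    (hS : Subgroup.closure S = ⊤) : ∃ C, ∀ k : ℤ, k.natAbs ≤ C * wordLength S (α ^ k) := by
  obtain ⟨C, hC⟩ := exists_losesAtMost_mul_wordLength hn hfin hS
  obtain ⟨r, q, w, hw, hm⟩ := exists_attracting_cone hn α.2
    (by rwa [Submonoid.isOfFinOrder_coe])
  refine ⟨r.natAbs * C, fun k => ?_⟩
  obtain ⟨p, hp, hk⟩ := hm.pow_append k.natAbs
  -- The inverse of `α ^ (r * |k|)` contracts the cone under `p` to the cone under `q`.
  have hinv : MapsCone ((((α ^ r) ^ k.natAbs)⁻¹ : HigmanThompson n) :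
      CantorSpace n ≃ₜ CantorSpace n) p q := by
    simpa using hk.inv
  have h1 := hinv.length_le_of_losesAtMost hn (hC _)
  have h2 : wordLength S ((α ^ r) ^ k.natAbs)⁻¹ ≤ r.natAbs * wordLength S (α ^ k) := by
    refine (wordLength_inv_le hS _).trans ?_
    rcases k.natAbs_eq with h | h
    · rw [← zpow_natCast, zpow_comm, ← h]
      exact wordLength_zpow_le hS _ _
    · have e : (α ^ r) ^ k.natAbs = (α ^ k) ^ (-r) := by
        rw [← zpow_natCast, ← zpow_mul, ← zpow_mul]
        congr 1
        rw [show (k.natAbs : ℤ) = -k by omega]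
        ring
      rw [e]
      simpa using wordLength_zpow_le hS (α ^ k) (-r)
  have h3 : k.natAbs ≤ k.natAbs * w.length :=
    Nat.le_mul_of_pos_right _ (List.length_pos_iff.2 hw)
  calc k.natAbs ≤ wordLength S ((α ^ r) ^ k.natAbs)⁻¹ * C := by omega
    _ ≤ r.natAbs * wordLength S (α ^ k) * C := Nat.mul_le_mul_right C h2
    _ = r.natAbs * C * wordLength S (α ^ k) := by ring

end Undistorted

theorem theorem1p3 (n : ℕ) (hn : 2 ≤ n) (α : HigmanThompson n) (hα : ¬ IsOfFinOrder α) :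
    IsUndistorted (Subgroup.zpowers α) := by
  refine ⟨fg_higmanThompson hn, (Group.fg_iff_subgroup_fg _).2
    ⟨{α}, by rw [Finset.coe_singleton, Subgroup.zpowers_eq_closure]⟩,
    fun S T hS hSgen _ hTgen => ?_⟩
  obtain ⟨C, hC⟩ := exists_natAbs_le_mul_wordLength hn hα hS hSgen
  let a : Subgroup.zpowers α := ⟨α, Subgroup.mem_zpowers α⟩
  refine ⟨wordLength T a * C, fun h => ?_⟩
  obtain ⟨k, hk⟩ := Subgroup.mem_zpowers_iff.1 h.2
  have ha : h = a ^ k := Subtype.ext (by simpa [a] using hk.symm)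
  calc wordLength T h ≤ k.natAbs * wordLength T a := ha ▸ wordLength_zpow_le hTgen a k
    _ ≤ C * wordLength S (h : HigmanThompson n) * wordLength T a :=
        Nat.mul_le_mul_right _ (hk ▸ hC k)
    _ = wordLength T a * C * wordLength S (h : HigmanThompson n) := by ring
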